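/- All graphs are simple, and $d_G$ denotes the graph distance. **Treewidth.** A tree-decomposition of a graph $H$ is a tree $T$ with sets $V_t\subseteq V(H)$ $(t\in V(T))$ such that $\bigcup_t V_t=V(H)$, every edge of $H$ has both ends in some $V_t$, and $V_t\cap V_{t''}\subseteq V_{t'}$ whenever $t'$ lies on the path of $T$ from $t$ to $t''$. Its width is $\sup_t(|V_t|-1)$, and $\mathrm{tw}(H)$ is the infimum of the widths of all tree-decompositions of $H$ (with $\mathrm{tw}(H)=0$ if $H$ has no vertices). **Asymptotic minors.** For $D\ge 1$, a $D$-fat $H$-minor of $G$ consists of non-empty connected subgraphs $(C_x)_{x\in V(H)}$ and paths $(P_e)_{e\in E(H)}$ of $G$ such that (i) $d_G(C_x,C_y)\ge D$ for all distinct $x,y\in V(H)$; (ii) for every $xy\in E(H)$, the path $P_{xy}$ joins a vertex of $C_x$ to a vertex of $C_y$, and none of its internal vertices lies in $\bigcup_{z\in V(H)}C_z$; (iii) $d_G(C_x,P_{yz})\ge D$ for all $x\in V(H)$ and $yz\in E(H)$ with $x\notin\{y,z\}$; (iv) $d_G(P_e,P_f)\ge D$ for all distinct $e,f\in E(H)$.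 The graph $H$ is an asymptotic minor of $G$ if $G$ has a $D$-fat $H$-minor for every $D\ge 1$. **Weak cop number.** Let $k,s_c,\rho,s_r,R$ be non-negative integers and $v\in V(G)$. In the game with these parameters, $k$ cops choose initial vertices $c_0^1,\dots,c_0^k$ of $G$, and then the robber, knowing these, chooses a vertex $r_0$. In stage $i\ge 1$ each cop first moves from $c_{i-1}^j$ to a vertex $c_i^j$ with $d_G(c_{i-1}^j,c_i^j)\le s_c$. If then $d_G(r_{i-1},c_i^j)\le\rho$ for some $j$, the robber is captured and the game ends. Otherwise the robber moves to a vertex $r_i$ along a path of $G$ from $r_{i-1}$ to $r_i$ of length at most $s_r$ all of whose vertices are at distance larger than $\rho$ from each of $c_i^1,\dots,c_i^k$. Both players have perfect information. The cops win if the robber is captured or there is $N>0$ with $d_G(v,r_i)>R$ for all $i\ge N$. The graph $G$ is $\mathsf{CopWin}(k,s_c,\rho,s_r,R)$ if for every $v\in V(G)$ the cops have a winning strategy in this game. It is $k$-weak cop win if there are $s_c\ge 1$ and $\rho\ge 0$ such that for all $s_r,R\ge 1$ it is $\mathsf{CopWin}(k,s_c,\rho,s_r,R)$. The weak cop number $\mathrm{wco}(G)\in\mathbb{N}\cup\{\infty\}$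 is the infimum of all integers $k\ge 0$ such that $G$ is $k$-weak cop win ($\infty$ if there is none). **Theorem.** Let $H$ be a finite graph, and let $G$ be a connected graph such that $H$ is an asymptotic minor of $G$. Then $$\mathrm{wco}(G)\ \ge\ \mathrm{tw}(H).$$ -/

import Mathlib

universe u v

namespace CoarseCops

/-! ### Tree-decompositions and treewidth -/

/-- A tree-decomposition of `G`: a tree `T` together with a family of bags `bag t ⊆ V(G)`, `t ∈ V(T)`. -/
structure TreeDecomposition {V : Type u} (G : SimpleGraph V) where
  /-- the nodes of the decomposition tree -/
  Node : Type u
  /-- the decomposition tree -/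
  T : SimpleGraph Node
  isTree : T.IsTree
  /-- the bags -/
  bag : Node → Set V
  /-- the bags cover `V(G)` -/
  exists_mem_bag : ∀ x : V, ∃ t, x ∈ bag t
  /-- if `t'` lies on the path of `T` from `t` to `t''`, then `V_t ∩ V_{t''} ⊆ V_{t'}` -/
  inter_subset : ∀ (t t'' : Node) (p : T.Walk t t''), p.IsPath →
    ∀ t' ∈ p.support, bag t ∩ bag t'' ⊆ bag t'
  /-- both ends of every edge lie in a common bag -/
  exists_adj_mem_bag : ∀ x y : V, G.Adj x y → ∃ t, x ∈ bag t ∧ y ∈ bag t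

/-- The width of a tree-decomposition: the supremum of `|V_t| - 1` over the nodes `t`. Subtraction in
`ℕ∞` is truncated; this matters only for the graph with no vertices, since for every other graph some
bag is non-empty. -/
noncomputable def TreeDecomposition.width {V : Type u} {G : SimpleGraph V}
    (d : TreeDecomposition G) : ℕ∞ :=
  ⨆ t : d.Node, ((d.bag t).encard - 1)

/-- The treewidth: the infimum of the widths of all tree-decompositions. (The graph with no vertices
gets treewidth `0` here.) -/
noncomputable def treewidth {V : Type u} (G : SimpleGraph V) : ℕ∞ :=
  ⨅ d : TreeDecomposition G, d.width

/-! ### Fat minors and asymptotic minors -/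

/-- `d_G(A, B) ≥ D` for two sets of vertices. -/
def FarApart {V : Type u} (G : SimpleGraph V) (D : ℕ) (A B : Set V) : Prop :=
  ∀ a ∈ A, ∀ b ∈ B, (D : ℕ∞) ≤ G.edist a b

/-- A `D`-fat `H`-minor of `G`. -/
structure FatMinor {W : Type v} {V : Type u} (D : ℕ) (H : SimpleGraph W) (G : SimpleGraph V) where
  /-- the branch sets `C_x`, `x ∈ V(H)` -/
  branch : W → G.Subgraph
  /-- every `C_x` is connected (and in particular non-empty) -/
  branch_connected : ∀ x, (branch x).Connected
  /-- one end of `P_e` -/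
  src : H.edgeSet → V
  /-- the other end of `P_e` -/
  tgt : H.edgeSet → V
  /-- the paths `P_e`, `e ∈ E(H)` -/
  path : ∀ e : H.edgeSet, G.Walk (src e) (tgt e)
  path_isPath : ∀ e, (path e).IsPath
  /-- `P_{xy}` joins a vertex of `C_x` to a vertex of `C_y` -/
  path_ends : ∀ (x y : W) (h : s(x, y) ∈ H.edgeSet),
    (src ⟨s(x, y), h⟩ ∈ (branch x).verts ∧ tgt ⟨s(x, y), h⟩ ∈ (branch y).verts) ∨
    (src ⟨s(x, y), h⟩ ∈ (branch y).verts ∧ tgt ⟨s(x, y), h⟩ ∈ (branch x).verts)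
  /-- no internal vertex of `P_e` lies in a branch set -/
  path_internally_disjoint : ∀ (e : H.edgeSet), ∀ w ∈ (path e).support,
    w ≠ src e → w ≠ tgt e → ∀ z, w ∉ (branch z).verts
  branch_far : ∀ x y, x ≠ y → FarApart G D (branch x).verts (branch y).verts
  branch_path_far : ∀ (x : W) (e : H.edgeSet), x ∉ (e : Sym2 W) →
    FarApart G D (branch x).verts {w | w ∈ (path e).support}
  path_far : ∀ e f : H.edgeSet, e ≠ f →
    FarApart G D {w | w ∈ (path e).support} {w | w ∈ (path f).support}

/-- `H` is an asymptotic minor of `G`: there is a `D`-fat `H`-minor in `G` for every `D ≥ 1`. -/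
def IsAsymptoticMinor {W : Type v} {V : Type u} (H : SimpleGraph W) (G : SimpleGraph V) : Prop :=
  ∀ D : ℕ, 1 ≤ D → Nonempty (FatMinor D H G)

/-! ### The game -/

/-- A strategy for `k` cops of speed `sc`. It maps the list of the robber's positions so far, the most
recent one first, to the resulting positions of the cops: `pos []` are the initial positions
`c_0`, and `pos [r_{i-1}, …, r_0]` are the positions `c_i` after the cops' move in stage `i`. In one
move every cop moves by a distance of at most `sc`. -/
structure CopStrategy {V : Type u} (G : SimpleGraph V) (k sc : ℕ) where
  /-- the positions of the cops, given the history of the robber -/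
  pos : List V → Fin k → V
  speed : ∀ (h : List V) (x : V) (j : Fin k), G.edist (pos h j) (pos (x :: h) j) ≤ sc

/-- `history r i = [r_{i-1}, …, r_0]`. -/
def history {V : Type u} (r : ℕ → V) : ℕ → List V
  | 0 => []
  | i + 1 => r i :: history r i

/-- The position `c_i` of the cops when they follow `σ` and the robber's positions are
`r_0, r_1, …`; it depends only on `r_0, …, r_{i-1}`. -/
def CopStrategy.copsAt {V : Type u} {G : SimpleGraph V} {k sc : ℕ} (σ : CopStrategy G k sc)
    (r : ℕ → V) (i : ℕ) : Fin k → V :=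
  σ.pos (history r i)

/-- The robber is captured during stage `i + 1`: some cop is within distance `ρ` of `r_i` after the
cops' move to `c_{i+1}`. -/
def CopStrategy.CapturedAt {V : Type u} {G : SimpleGraph V} {k sc : ℕ} (σ : CopStrategy G k sc)
    (ρ : ℕ) (r : ℕ → V) (i : ℕ) : Prop :=
  ∃ j : Fin k, G.edist (r i) (σ.copsAt r (i + 1) j) ≤ ρ

/-- With the cops at the positions `c`, the robber may move from `x` to `y`: there is a path from `x`
to `y` of length at most `sr` all of whose vertices are at distance larger than `ρ` from all cops. -/
def RobberMove {V : Type u} (G : SimpleGraph V) {k : ℕ} (ρ sr : ℕ) (c : Fin k → V) (x y : V) :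
    Prop :=
  ∃ p : G.Walk x y, p.IsPath ∧ p.length ≤ sr ∧
    ∀ w ∈ p.support, ∀ j : Fin k, (ρ : ℕ∞) < G.edist w (c j)

/-- The sequence `r` is a play of the robber against `σ` following the rules: in every stage, unless
the robber has been captured in that stage or before, he makes an allowed move. (Once he has been
captured the game is over, and the rest of the sequence is irrelevant.) -/
def CopStrategy.IsRobberPlay {V : Type u} {G : SimpleGraph V} {k sc : ℕ} (σ : CopStrategy G k sc)
    (ρ sr : ℕ) (r : ℕ → V) : Prop :=
  ∀ i : ℕ, (∀ i' ≤ i, ¬ σ.CapturedAt ρ r i') →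
    RobberMove G ρ sr (σ.copsAt r (i + 1)) (r i) (r (i + 1))

/-- Following `σ`, the cops eventually protect the ball of radius `R` around `v`: against every play
of the robber, he is captured or from some stage on he stays outside the ball. -/
def CopStrategy.Protects {V : Type u} {G : SimpleGraph V} {k sc : ℕ} (σ : CopStrategy G k sc)
    (ρ sr R : ℕ) (v : V) : Prop :=
  ∀ r : ℕ → V, σ.IsRobberPlay ρ sr r →
    (∃ i, σ.CapturedAt ρ r i) ∨ ∃ N > 0, ∀ i ≥ N, (R : ℕ∞) < G.edist v (r i)

/-- `CopWin(k, sc, ρ, sr, R)`: for every vertex `v`, `k` cops with speed `sc` and reach `ρ` can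
eventually protect the ball of radius `R` around `v` against a robber of speed `sr`. -/
def CopWin {V : Type u} (G : SimpleGraph V) (k sc ρ sr R : ℕ) : Prop :=
  ∀ v : V, ∃ σ : CopStrategy G k sc, σ.Protects ρ sr R v

/-- `G` is `k`-weak cop win. -/
def IsWeakCopWin {V : Type u} (G : SimpleGraph V) (k : ℕ) : Prop :=
  ∃ sc > 0, ∃ ρ : ℕ, ∀ sr > 0, ∀ R > 0, CopWin G k sc ρ sr R

/-- The weak cop number: the infimum of the `k` such that `G` is `k`-weak cop win, and `∞` if there
is none. -/
noncomputable def weakCopNumber {V : Type u} (G : SimpleGraph V) : ℕ∞ :=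
  ⨅ (k : ℕ) (_ : IsWeakCopWin G k), (k : ℕ∞)

end CoarseCops

/-! Two facts combine. By bramble duality, if `H` has treewidth above `k`, some bramble of `H` has
no cover with at most `k + 1` vertices (`treewidth_le_of_forall_bramble`). Such a bramble lets a
robber on `G` survive `k` cops (`not_isWeakCopWin_of_bramble`).

Duality is proved from larger brambles to smaller ones (`hasDecomp_of_forall_bramble`). Given a
minimum cover `X` of `B`, it suffices to decompose `X ∪ C` for each component `C` of `H - X`. If `C`
touches all of `B`, a decomposition for `B ∪ {C}` is restricted to `X ∪ C`, and minimality of `X`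
keeps the bags small (`DecompOn.ncard_restrict_le`).

For the game, take a minor so fat that each cop is near the parts at only one vertex of `H`, the
cop's shadow. The robber sits in a branch set belonging to a bramble set that avoids all shadows. A
part blocked after a move of the cops is near the old and the new position of one cop, so it lies at
both shadows of that cop. Hence the shadows can be exchanged one at a time. Two consecutive shadow
sets have at most `k + 1` vertices together, so one bramble set avoids both and links them
(`exists_region_walk`). -/

namespace CoarseCops

/-! ### Separation in trees -/

/-- Every walk of `T` from `s` to `r` passes through `t`. -/
def Separates {N : Type*} (T : SimpleGraph N) (t s r : N) : Prop :=
  ∀ p : T.Walk s r, t ∈ p.support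

lemma Separates.symm {N : Type*} {T : SimpleGraph N} {t s r : N} (h : Separates T t s r) :
    Separates T t r s := fun p => by simpa using h p.reverse

lemma Separates.split {N : Type*} {T : SimpleGraph N} {t s r : N} (h : Separates T t s r) (m : N) :
    Separates T t s m ∨ Separates T t m r := by
  by_contra! hc
  simp only [Separates, not_forall] at hc
  obtain ⟨⟨p, hp⟩, q, hq⟩ := hc
  have := h (p.append q)
  rw [SimpleGraph.Walk.mem_support_append_iff] at this
  tauto

lemma Separates.trans {N : Type*} {T : SimpleGraph N} {t t' s r : N} (h : Separates T t s r)
    (h' : Separates T t' t r) : Separates T t' s r := by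
  classical
  intro p
  exact p.support_dropUntil_subset_support (h p) (h' (p.dropUntil t (h p)))

/-- Shortcutting any walk of a tree gives the unique path. This translates the path axiom of
`TreeDecomposition`. -/
lemma Separates.of_isPath {N : Type*} {T : SimpleGraph N} (hT : T.IsTree) {t s r : N}
    {p : T.Walk s r} (hp : p.IsPath) (ht : t ∈ p.support) : Separates T t s r := by
  classical
  intro q
  have : p = q.bypass := (hT.existsUnique_path s r).unique hp q.bypass_isPath
  exact q.support_bypass_subset_support (this ▸ ht)

/-! ### Joining two trees by an edge -/

/-- No edge of the sum changes sides. The edges are tracked because acyclicity is tested by bridges.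
-/
lemma exists_walk_of_sum {M N : Type*} {G : SimpleGraph M} {H : SimpleGraph N}
    {x y : M ⊕ N} (p : (G.sum H).Walk x y) :
    (∀ a b, x = .inl a → y = .inl b → ∃ q : G.Walk a b, q.edges.map (Sym2.map .inl) = p.edges) ∧
    (∀ a b, x = .inr a → y = .inr b → ∃ q : H.Walk a b, q.edges.map (Sym2.map .inr) = p.edges) := by
  induction p with
  | nil =>
    constructor
    · rintro a b rfl h; cases h; exact ⟨.nil, rfl⟩
    · rintro a b rfl h; cases h; exact ⟨.nil, rfl⟩
  | @cons x z y h p ih =>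
    constructor
    · rintro a b rfl rfl
      rcases z with c | c
      · obtain ⟨q, hq⟩ := ih.1 c b rfl rfl
        exact ⟨.cons (by simpa using h) q, by simp [hq]⟩
      · simp at h
    · rintro a b rfl rfl
      rcases z with c | c
      · simp at h
      · obtain ⟨q, hq⟩ := ih.2 c b rfl rfl
        exact ⟨.cons (by simpa using h) q, by simp [hq]⟩

lemma isAcyclic_sum {M N : Type*} {G : SimpleGraph M} {H : SimpleGraph N}
    (hG : G.IsAcyclic) (hH : H.IsAcyclic) : (G.sum H).IsAcyclic := by
  rw [SimpleGraph.isAcyclic_iff_forall_adj_isBridge] at *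
  rintro (a | a) (b | b) h
  · rw [SimpleGraph.isBridge_iff_forall_walk_mem_edges]
    intro p
    obtain ⟨q, hq⟩ := (exists_walk_of_sum p).1 a b rfl rfl
    rw [← hq]
    have := SimpleGraph.isBridge_iff_forall_walk_mem_edges.1 (hG (by simpa using h)) q
    exact List.mem_map.2 ⟨_, this, rfl⟩
  · simp at h
  · simp at h
  · rw [SimpleGraph.isBridge_iff_forall_walk_mem_edges]
    intro p
    obtain ⟨q, hq⟩ := (exists_walk_of_sum p).2 a b rfl rfl
    rw [← hq]
    have := SimpleGraph.isBridge_iff_forall_walk_mem_edges.1 (hH (by simpa using h)) q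
    exact List.mem_map.2 ⟨_, this, rfl⟩

/-- The disjoint union of two graphs with an edge added between `s₁` and `s₂`. -/
def joinGraph {M N : Type*} (G : SimpleGraph M) (H : SimpleGraph N) (s₁ : M) (s₂ : N) :
    SimpleGraph (M ⊕ N) := G.sum H ⊔ SimpleGraph.edge (.inl s₁) (.inr s₂)

lemma isTree_joinGraph {M N : Type*} {G : SimpleGraph M} {H : SimpleGraph N}
    (hG : G.IsTree) (hH : H.IsTree) (s₁ : M) (s₂ : N) : (joinGraph G H s₁ s₂).IsTree :=
  ⟨hG.1.sum_sup_edge hH.1, (isAcyclic_sum hG.2 hH.2).sup_edge_of_not_reachable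
    (SimpleGraph.not_reachable_sum_inl_inr _ _)⟩

/-- The first graph is a subgraph of the joined graph. -/
def joinInl {M N : Type*} (G : SimpleGraph M) (H : SimpleGraph N) (s₁ : M) (s₂ : N) :
    G →g joinGraph G H s₁ s₂ where
  toFun := .inl
  map_rel' h := by simp [joinGraph, h]

/-- The second graph is a subgraph of the joined graph. -/
def joinInr {M N : Type*} (G : SimpleGraph M) (H : SimpleGraph N) (s₁ : M) (s₂ : N) :
    H →g joinGraph G H s₁ s₂ where
  toFun := .inr
  map_rel' h := by simp [joinGraph, h]

lemma joinGraph_adj {M N : Type*} (G : SimpleGraph M) (H : SimpleGraph N) (s₁ : M) (s₂ : N) :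
    (joinGraph G H s₁ s₂).Adj (joinInl G H s₁ s₂ s₁) (joinInr G H s₁ s₂ s₂) := by
  refine .inr ((SimpleGraph.edge_adj ..).2 ⟨.inl ⟨rfl, rfl⟩, Sum.inl_ne_inr⟩)

/-! ### Partial tree-decompositions and their gluing -/

/-- A tree-decomposition of the subgraph of `H` induced by `A`. -/
structure DecompOn {W : Type v} (H : SimpleGraph W) (A : Set W) where
  /-- the nodes of the decomposition tree -/
  Node : Type v
  /-- the decomposition tree -/
  T : SimpleGraph Node
  isTree : T.IsTree
  /-- the bags -/
  bag : Node → Set W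
  bag_subset : ∀ t, bag t ⊆ A
  cover : ∀ x ∈ A, ∃ t, x ∈ bag t
  sep : ∀ t s r, Separates T t s r → bag s ∩ bag r ⊆ bag t
  adj : ∀ x ∈ A, ∀ y ∈ A, H.Adj x y → ∃ t, x ∈ bag t ∧ y ∈ bag t

/-- The decomposition with a single bag. -/
def DecompOn.single {W : Type v} (H : SimpleGraph W) (A : Set W) : DecompOn H A where
  Node := PUnit
  T := ⊥
  isTree := .of_subsingleton
  bag _ := A
  bag_subset _ := subset_rfl
  cover _ hx := ⟨⟨⟩, hx⟩
  sep _ _ _ _ := Set.inter_subset_left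
  adj _ hx _ hy _ := ⟨⟨⟩, hx, hy⟩

/-- Two decompositions are joined by an edge between nodes whose bags contain the intersection of
the two ground sets. -/
def DecompOn.join {W : Type v} {H : SimpleGraph W} {A₁ A₂ : Set W} (d₁ : DecompOn H A₁)
    (d₂ : DecompOn H A₂) (s₁ : d₁.Node) (s₂ : d₂.Node) (h₁ : A₁ ∩ A₂ ⊆ d₁.bag s₁)
    (h₂ : A₁ ∩ A₂ ⊆ d₂.bag s₂)
    (hadj : ∀ x ∈ A₁, ∀ y ∈ A₂, H.Adj x y → x ∈ A₂ ∨ y ∈ A₁) : DecompOn H (A₁ ∪ A₂) where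
  Node := d₁.Node ⊕ d₂.Node
  T := joinGraph d₁.T d₂.T s₁ s₂
  isTree := isTree_joinGraph d₁.isTree d₂.isTree s₁ s₂
  bag := Sum.elim d₁.bag d₂.bag
  bag_subset := by
    rintro (t | t)
    · exact (d₁.bag_subset t).trans Set.subset_union_left
    · exact (d₂.bag_subset t).trans Set.subset_union_right
  cover := by
    rintro x (hx | hx)
    · obtain ⟨t, ht⟩ := d₁.cover x hx; exact ⟨.inl t, ht⟩
    · obtain ⟨t, ht⟩ := d₂.cover x hx; exact ⟨.inr t, ht⟩
  sep := by
    -- A common vertex lies in both linking bags. Fixing one half of a walk across the new edge and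
    -- varying the other shows that `t` separates `a` from `s₁`, or `s₂` from `b`.
    have key : ∀ t a b, Separates (joinGraph d₁.T d₂.T s₁ s₂) t (.inl a) (.inr b) →
        d₁.bag a ∩ d₂.bag b ⊆ Sum.elim d₁.bag d₂.bag t := by
      rintro t a b h x ⟨hxa, hxb⟩
      have hx : x ∈ A₁ ∩ A₂ := ⟨d₁.bag_subset a hxa, d₂.bag_subset b hxb⟩
      replace h : Separates _ t (joinInl d₁.T d₂.T s₁ s₂ a) (joinInr d₁.T d₂.T s₁ s₂ b) := h
      have hw : ∀ (p : d₁.T.Walk a s₁) (q : d₂.T.Walk s₂ b),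
          (∃ m ∈ p.support, t = .inl m) ∨ (∃ m ∈ q.support, t = .inr m) := by
        intro p q
        have := h ((p.map (joinInl d₁.T d₂.T s₁ s₂)).append
          (.cons (joinGraph_adj d₁.T d₂.T s₁ s₂) (q.map (joinInr d₁.T d₂.T s₁ s₂))))
        rw [SimpleGraph.Walk.mem_support_append_iff] at this
        simp only [SimpleGraph.Walk.support_map, SimpleGraph.Walk.support_cons, List.mem_cons,
          List.mem_map] at this
        rcases this with ⟨m, hm, rfl⟩ | rfl | ⟨m, hm, rfl⟩
        · exact .inl ⟨m, hm, rfl⟩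
        · exact .inl ⟨s₁, p.end_mem_support, rfl⟩
        · exact .inr ⟨m, hm, rfl⟩
      obtain ⟨p₀⟩ := d₁.isTree.1.preconnected a s₁
      obtain ⟨q₀⟩ := d₂.isTree.1.preconnected s₂ b
      rcases t with t | t
      · refine d₁.sep t a s₁ (fun p => ?_) ⟨hxa, h₁ hx⟩
        rcases hw p q₀ with ⟨m, hm, h⟩ | ⟨m, hm, h⟩ <;> cases h
        exact hm
      · refine d₂.sep t s₂ b (fun p => ?_) ⟨h₂ hx, hxb⟩
        rcases hw p₀ p with ⟨m, hm, h⟩ | ⟨m, hm, h⟩ <;> cases h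
        exact hm
    rintro t (a | a) (b | b) h
    · replace h : Separates _ t (joinInl d₁.T d₂.T s₁ s₂ a) (joinInl d₁.T d₂.T s₁ s₂ b) := h
      have hw : ∀ (p : d₁.T.Walk a b), ∃ m ∈ p.support, t = .inl m := by
        intro p
        have := h (p.map (joinInl d₁.T d₂.T s₁ s₂))
        rw [SimpleGraph.Walk.support_map, List.mem_map] at this
        obtain ⟨m, hm, rfl⟩ := this
        exact ⟨m, hm, rfl⟩
      obtain ⟨p₀⟩ := d₁.isTree.1.preconnected a b
      obtain ⟨m, hm, rfl⟩ := hw p₀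
      refine d₁.sep m a b (fun p => ?_)
      obtain ⟨m', hm', h'⟩ := hw p
      cases h'
      exact hm'
    · exact key t a b h
    · intro x hx
      exact key t b a h.symm hx.symm
    · replace h : Separates _ t (joinInr d₁.T d₂.T s₁ s₂ a) (joinInr d₁.T d₂.T s₁ s₂ b) := h
      have hw : ∀ (p : d₂.T.Walk a b), ∃ m ∈ p.support, t = .inr m := by
        intro p
        have := h (p.map (joinInr d₁.T d₂.T s₁ s₂))
        rw [SimpleGraph.Walk.support_map, List.mem_map] at this
        obtain ⟨m, hm, rfl⟩ := this
        exact ⟨m, hm, rfl⟩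
      obtain ⟨p₀⟩ := d₂.isTree.1.preconnected a b
      obtain ⟨m, hm, rfl⟩ := hw p₀
      refine d₂.sep m a b (fun p => ?_)
      obtain ⟨m', hm', h'⟩ := hw p
      cases h'
      exact hm'
  adj := by
    have l : ∀ x ∈ A₁, ∀ y ∈ A₁, H.Adj x y →
        ∃ t, x ∈ Sum.elim d₁.bag d₂.bag t ∧ y ∈ Sum.elim d₁.bag d₂.bag t := by
      intro x hx y hy h
      obtain ⟨t, ht⟩ := d₁.adj x hx y hy h
      exact ⟨.inl t, ht⟩
    have r : ∀ x ∈ A₂, ∀ y ∈ A₂, H.Adj x y →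
        ∃ t, x ∈ Sum.elim d₁.bag d₂.bag t ∧ y ∈ Sum.elim d₁.bag d₂.bag t := by
      intro x hx y hy h
      obtain ⟨t, ht⟩ := d₂.adj x hx y hy h
      exact ⟨.inr t, ht⟩
    rintro x (hx | hx) y (hy | hy) h
    · exact l x hx y hy h
    · rcases hadj x hx y hy h with h' | h'
      · exact r x h' y hy h
      · exact l x hx y h' h
    · rcases hadj y hy x hx h.symm with h' | h'
      · exact r x hx y h' h
      · exact l x h' y hy h
    · exact r x hx y hy h

/-- A walk between two bags meets every bag that separates them. -/
lemma DecompOn.exists_mem_bag_of_walk {W : Type v} {H : SimpleGraph W}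
    (d : DecompOn H Set.univ) {t r : d.Node} {a b : W} (q : H.Walk a b) (s : d.Node)
    (ha : a ∈ d.bag s) (hb : b ∈ d.bag r) (h : Separates d.T t s r) :
    ∃ w ∈ q.support, w ∈ d.bag t := by
  induction q generalizing s with
  | nil => exact ⟨_, by simp, d.sep t s r h ⟨ha, hb⟩⟩
  | @cons a c b hac q ih =>
    obtain ⟨m, hm, hm'⟩ := d.adj a trivial c trivial hac
    rcases h.split m with h' | h'
    · exact ⟨a, by simp, d.sep t s m h' ⟨ha, hm⟩⟩
    · obtain ⟨w, hw, hw'⟩ := ih m hm' hb h'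
      exact ⟨w, by simp [hw], hw'⟩

/-- The subgraph of `H` induced by `A` has a tree-decomposition all of whose bags satisfy `P`,
and one of whose bags contains `X`. -/
def HasDecomp {W : Type v} (H : SimpleGraph W) (P : Set W → Prop) (A X : Set W) : Prop :=
  ∃ d : DecompOn H A, (∀ t, P (d.bag t)) ∧ ∃ t, X ⊆ d.bag t

lemma HasDecomp.single {W : Type v} (H : SimpleGraph W) {P : Set W → Prop} {A : Set W}
    (hA : P A) : HasDecomp H P A A :=
  ⟨DecompOn.single H A, fun _ => hA, ⟨⟩, subset_rfl⟩

lemma HasDecomp.join {W : Type v} {H : SimpleGraph W} {P : Set W → Prop} {A₁ A₂ X Y : Set W}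
    (h₁ : HasDecomp H P A₁ X) (h₂ : HasDecomp H P A₂ Y) (hX : A₁ ∩ A₂ ⊆ X) (hY : A₁ ∩ A₂ ⊆ Y)
    (hadj : ∀ x ∈ A₁, ∀ y ∈ A₂, H.Adj x y → x ∈ A₂ ∨ y ∈ A₁) : HasDecomp H P (A₁ ∪ A₂) X := by
  obtain ⟨d₁, hd₁, s₁, hs₁⟩ := h₁
  obtain ⟨d₂, hd₂, s₂, hs₂⟩ := h₂
  refine ⟨d₁.join d₂ s₁ s₂ (hX.trans hs₁) (hY.trans hs₂) hadj, ?_, .inl s₁, hs₁⟩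
  rintro (t | t)
  · exact hd₁ t
  · exact hd₂ t

/-! ### Brambles and components -/

/-- `U` is non-empty and induces a connected subgraph of `H`. -/
def ConnSet {W : Type v} (H : SimpleGraph W) (U : Set W) : Prop :=
  U.Nonempty ∧ ∀ a ∈ U, ∀ b ∈ U, ∃ p : H.Walk a b, ∀ w ∈ p.support, w ∈ U

/-- Two sets of vertices touch if they intersect or are joined by an edge. -/
def Touch {W : Type v} (H : SimpleGraph W) (U U' : Set W) : Prop :=
  ∃ a ∈ U, ∃ b ∈ U', a = b ∨ H.Adj a b

lemma Touch.symm {W : Type v} {H : SimpleGraph W} {U U' : Set W} (h : Touch H U U') :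
    Touch H U' U := by
  obtain ⟨a, ha, b, hb, h⟩ := h
  exact ⟨b, hb, a, ha, h.imp Eq.symm (·.symm)⟩

/-- A bramble: a set of pairwise touching connected sets. -/
def IsBramble {W : Type v} (H : SimpleGraph W) (B : Set (Set W)) : Prop :=
  (∀ U ∈ B, ConnSet H U) ∧ ∀ U ∈ B, ∀ U' ∈ B, Touch H U U'

/-- `X` meets every element of `B`. -/
def Covers {W : Type v} (B : Set (Set W)) (X : Set W) : Prop :=
  ∀ U ∈ B, (U ∩ X).Nonempty

/-- A bag is admissible for `B` if it is small or does not cover `B`. -/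
def Admissible {W : Type v} (k : ℕ) (B : Set (Set W)) (S : Set W) : Prop :=
  k < S.ncard → ¬ Covers B S

/-- `C` is a connected set disjoint from `X` whose neighbours outside `C` all lie in `X`. -/
structure IsComp {W : Type v} (H : SimpleGraph W) (X C : Set W) : Prop where
  conn : ConnSet H C
  disj : ∀ w ∈ C, w ∉ X
  closed : ∀ y ∈ C, ∀ z, H.Adj y z → z ∉ X → z ∈ C

/-- Take all vertices reachable from `c` outside `X`. The minimality clause keeps `C` inside the set
`A` of the induction in `HasDecomp.of_isComp`. -/
lemma exists_isComp {W : Type v} (H : SimpleGraph W) (X : Set W) {c : W} (hc : c ∉ X) :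
    ∃ C, IsComp H X C ∧ c ∈ C ∧
      ∀ A : Set W, c ∈ A → (∀ y ∈ A, y ∉ X → ∀ z, H.Adj y z → z ∉ X → z ∈ A) → C ⊆ A := by
  classical
  let C : Set W := {y | ∃ p : H.Walk c y, ∀ w ∈ p.support, w ∉ X}
  have hsub : ∀ {y} (p : H.Walk c y), (∀ w ∈ p.support, w ∉ X) → ∀ w ∈ p.support, w ∈ C :=
    fun p hp w hw => ⟨p.takeUntil w hw, fun z hz => hp z (p.support_takeUntil_subset_support hw hz)⟩
  have hcC : c ∈ C := ⟨.nil, by simpa using hc⟩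
  refine ⟨C, ⟨⟨⟨c, hcC⟩, ?_⟩, ?_, ?_⟩, hcC, ?_⟩
  · rintro a ⟨p, hp⟩ b ⟨q, hq⟩
    refine ⟨p.reverse.append q, fun w hw => ?_⟩
    rw [SimpleGraph.Walk.mem_support_append_iff] at hw
    rcases hw with hw | hw
    · exact hsub p hp w (by simpa using hw)
    · exact hsub q hq w hw
  · rintro w ⟨p, hp⟩
    exact hp w p.end_mem_support
  · rintro y ⟨p, hp⟩ z h hz
    refine ⟨p.concat h, fun w hw => ?_⟩
    rw [SimpleGraph.Walk.support_concat] at hw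
    simp only [List.mem_append, List.mem_singleton] at hw
    rcases hw with hw | rfl
    · exact hp w hw
    · exact hz
  · rintro A hcA hA y ⟨p, hp⟩
    clear hsub hcC
    induction p with
    | nil => exact hcA
    | @cons a b y h p ih =>
      have hb : b ∉ X := hp b (by simp)
      exact ih hb (hA a hcA hc b h hb) (fun w hw => hp w (by simp [hw]))

/-- A decomposition of `H` is assembled from decompositions of the parts `X ∪ C`, where `C` runs
over the components of `H - X`. -/
lemma HasDecomp.of_isComp {W : Type v} [Finite W] {H : SimpleGraph W} {P : Set W → Prop}
    {X : Set W} (hX : P X) (h : ∀ C, IsComp H X C → HasDecomp H P (X ∪ C) X) :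
    HasDecomp H P Set.univ X := by
  -- Induction on the size of `A`, which is `X` together with some components of `H - X`; one
  -- component is split off at a time.
  suffices hs : ∀ n, ∀ A : Set W, A.ncard = n → X ⊆ A →
      (∀ y ∈ A, y ∉ X → ∀ z, H.Adj y z → z ∉ X → z ∈ A) → HasDecomp H P A X from
    hs _ Set.univ rfl (Set.subset_univ _) (fun _ _ _ _ _ _ => trivial)
  intro n
  induction n using Nat.strong_induction_on with
  | _ n ih =>
  intro A hn hXA hA
  by_cases hAX : A ⊆ X
  · obtain rfl := hXA.antisymm hAX
    exact HasDecomp.single H hX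
  obtain ⟨c, hcA, hcX⟩ := Set.not_subset.1 hAX
  obtain ⟨C, hC, hcC, hmin⟩ := exists_isComp H X hcX
  have hCA : C ⊆ A := hmin A hcA hA
  have hlt : (A \ C).ncard < n :=
    hn ▸ Set.ncard_lt_ncard ⟨Set.sdiff_subset, fun h => (h hcA).2 hcC⟩ (Set.toFinite _)
  have hXA' : X ⊆ A \ C := fun x hx => ⟨hXA hx, fun hxC => hC.disj x hxC hx⟩
  have h2 := ih _ hlt (A \ C) rfl hXA' (fun y hy hyX z hyz hz =>
    ⟨hA y hy.1 hyX z hyz hz, fun hzC => hy.2 (hC.closed z hzC y hyz.symm hyX)⟩)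
  have hint : (X ∪ C) ∩ (A \ C) ⊆ X := by
    rintro x ⟨hx | hx, hx'⟩
    · exact hx
    · exact absurd hx hx'.2
  have := (h C hC).join h2 hint hint (by
    rintro x (hx | hx) y hy hxy
    · exact .inl (hXA' hx)
    · by_cases hyX : y ∈ X
      · exact .inr (.inl hyX)
      · exact absurd (hC.closed x hx y hxy hyX) hy.2)
  convert this using 1
  ext x
  have h3 := @hXA x
  have h4 := @hCA x
  simp only [Set.mem_union, Set.mem_sdiff]
  tauto

/-- A walk that starts outside `C` and ends in `X` has an initial segment that ends in `X` and is
otherwise disjoint from `X` and `C`. -/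
lemma IsComp.exists_initial_walk {W : Type v} {H : SimpleGraph W} {X C : Set W}
    (hC : IsComp H X C) {a b : W} (p : H.Walk a b) (ha : a ∉ C) (hb : b ∈ X) :
    ∃ z ∈ X, ∃ q : H.Walk a z, (∀ w ∈ q.support, w ∈ p.support) ∧
      ∀ w ∈ q.support, w = z ∨ (w ∉ X ∧ w ∉ C) := by
  induction p with
  | nil => exact ⟨_, hb, .nil, by simp, by simp⟩
  | @cons a c b h p ih =>
    by_cases haX : a ∈ X
    · exact ⟨a, haX, .nil, by simp, by simp⟩
    obtain ⟨z, hz, q, hq, hq'⟩ := ih (fun hc => ha (hC.closed c hc a h.symm haX)) hb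
    refine ⟨z, hz, .cons h q, ?_, ?_⟩
    · intro w hw
      rw [SimpleGraph.Walk.support_cons, List.mem_cons] at hw ⊢
      exact hw.imp_right (hq w)
    · intro w hw
      rw [SimpleGraph.Walk.support_cons, List.mem_cons] at hw
      rcases hw with rfl | hw
      · exact .inr ⟨haX, ha⟩
      · exact hq' w hw

/-! ### Restricting a decomposition -/

/-- The restriction of a decomposition to `X ∪ C`, where every `x ∈ X` is added to the bags on the
path from `s` to a node whose bag contains `x`. -/
def DecompOn.restrict {W : Type v} {H : SimpleGraph W} (d : DecompOn H Set.univ) (X C : Set W)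
    (s : d.Node) (τ : W → d.Node) (hτ : ∀ x, x ∈ d.bag (τ x)) : DecompOn H (X ∪ C) where
  Node := d.Node
  T := d.T
  isTree := d.isTree
  bag t := (d.bag t ∩ (X ∪ C)) ∪ {x | x ∈ X ∧ Separates d.T t s (τ x)}
  bag_subset := by
    rintro t x (hx | hx)
    · exact hx.2
    · exact .inl hx.1
  cover x hx := ⟨τ x, .inl ⟨hτ x, hx⟩⟩
  sep := by
    -- When `x` was added at `a` or `b`, split at `τ x`: on a stretch between nodes originally
    -- containing `x` the old axiom applies, and on a stretch from an added node to `τ x` the node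
    -- `t` also separates `s` from `τ x`.
    rintro t a b h x ⟨⟨hxa, hx⟩ | ⟨hx, hxa⟩, ⟨hxb, -⟩ | ⟨hX, hxb⟩⟩
    · exact .inl ⟨d.sep t a b h ⟨hxa, hxb⟩, hx⟩
    · rcases h.split (τ x) with h' | h'
      · exact .inl ⟨d.sep _ _ _ h' ⟨hxa, hτ x⟩, hx⟩
      · exact .inr ⟨hX, hxb.trans h'.symm⟩
    · rcases h.split (τ x) with h' | h'
      · exact .inr ⟨hx, hxa.trans h'⟩
      · exact .inl ⟨d.sep _ _ _ h' ⟨hτ x, hxb⟩, .inl hx⟩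
    · rcases h.split (τ x) with h' | h'
      · exact .inr ⟨hx, hxa.trans h'⟩
      · exact .inr ⟨hx, hxb.trans h'.symm⟩
  adj x hx y hy h := by
    obtain ⟨t, ht, ht'⟩ := d.adj x trivial y trivial h
    exact ⟨t, .inl ⟨ht, hx⟩, .inl ⟨ht', hy⟩⟩

/-- The bags of the restriction are not larger than the original ones, if `X` is a minimum cover of
a bramble that is covered by the bag of `s`. -/
lemma DecompOn.ncard_restrict_le {W : Type v} [Finite W] {H : SimpleGraph W}
    (d : DecompOn H Set.univ) {B : Set (Set W)} (hB : IsBramble H B) {X C : Set W}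
    (hX : Covers B X) (hmin : ∀ Y, Covers B Y → X.ncard ≤ Y.ncard) (hC : IsComp H X C)
    (s : d.Node) (hs : Covers B (d.bag s)) (hsC : ∀ w ∈ d.bag s, w ∉ C)
    (τ : W → d.Node) (hτ : ∀ x, x ∈ d.bag (τ x)) (t : d.Node) :
    ((d.restrict X C s τ hτ).bag t).ncard ≤ (d.bag t).ncard := by
  let Z : Set W := {x | x ∈ X ∧ x ∉ d.bag t ∧ Separates d.T t s (τ x)}
  have hsub : (d.restrict X C s τ hτ).bag t ⊆ (d.bag t ∩ (X ∪ C)) ∪ Z := by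
    rintro x (hx | ⟨hx, hx'⟩)
    · exact .inl hx
    · by_cases hxt : x ∈ d.bag t
      · exact .inl ⟨hxt, .inl hx⟩
      · exact .inr ⟨hx, hxt, hx'⟩
  have h1 := (Set.ncard_le_ncard hsub (Set.toFinite _)).trans (Set.ncard_union_le _ _)
  have h2 := Set.ncard_inter_add_ncard_sdiff_eq_ncard (d.bag t) (X ∪ C) (Set.toFinite _)
  -- `Z` holds the added vertices; they must not outnumber the deleted ones. Otherwise exchanging
  -- `Z` for the deleted vertices makes `X` smaller, so the result misses some `U`.
  suffices h3 : Z.ncard ≤ (d.bag t \ (X ∪ C)).ncard by omega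
  by_contra! hlt
  have hZX : Z ⊆ X := fun x hx => hx.1
  have h4 := Set.ncard_sdiff_add_ncard_of_subset hZX (Set.toFinite _)
  have h5 := Set.ncard_union_le (X \ Z) (d.bag t \ (X ∪ C))
  have hnot : ¬ Covers B ((X \ Z) ∪ (d.bag t \ (X ∪ C))) := fun h => by
    have := hmin _ h
    omega
  simp only [Covers, not_forall, Set.not_nonempty_iff_eq_empty] at hnot
  obtain ⟨U, hU, hUe⟩ := hnot
  have hUe' : ∀ w ∈ U, w ∉ (X \ Z) ∪ (d.bag t \ (X ∪ C)) := fun w hw hw' =>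
    (hUe ▸ (⟨hw, hw'⟩ : w ∈ U ∩ _) : w ∈ (∅ : Set W))
  obtain ⟨a, haU, ha⟩ := hs U hU
  obtain ⟨b, hbU, hb⟩ := hX U hU
  obtain ⟨p, hp⟩ := (hB.1 U hU).2 a haU b hbU
  -- Inside `U`, go from the bag of `s` to the first vertex `z` of `X`, avoiding `C`. Since `z ∈ Z`,
  -- this walk meets the bag of `t`, either at `z` or at a deleted vertex; both are impossible.
  obtain ⟨z, hz, q, hqp, hq⟩ := hC.exists_initial_walk p (hsC a ha) hb
  have hzU : z ∈ U := hp z (hqp z q.end_mem_support)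
  have hzZ : z ∈ Z := by
    by_contra hzZ
    exact hUe' z hzU (.inl ⟨hz, hzZ⟩)
  obtain ⟨w, hw, hwt⟩ := d.exists_mem_bag_of_walk q s ha (hτ z) hzZ.2.2
  rcases hq w hw with rfl | ⟨hwX, hwC⟩
  · exact hzZ.2.1 hwt
  · exact hUe' w (hp w (hqp w hw)) (.inr ⟨hwt, by simp [hwX, hwC]⟩)

/-! ### Bramble duality -/

/-- If every bramble has a cover of size at most `k`, then for every bramble there is a
tree-decomposition with admissible bags. -/
theorem hasDecomp_of_forall_bramble {W : Type v} [Finite W] (H : SimpleGraph W) (k : ℕ)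
    (hk : ∀ B, IsBramble H B → ∃ X, Covers B X ∧ X.ncard ≤ k) (B : Set (Set W))
    (hB : IsBramble H B) : HasDecomp H (Admissible k B) Set.univ ∅ := by
  induction B using WellFoundedGT.induction with
  | _ B ih =>
  by_contra hno
  obtain ⟨X, hX, hmin⟩ : ∃ X, Covers B X ∧ ∀ Y, Covers B Y → X.ncard ≤ Y.ncard := by
    obtain ⟨X₀, hX₀, -⟩ := hk B hB
    obtain ⟨X, hX, hmin⟩ := exists_minimalFor_of_wellFoundedLT (Covers B) Set.ncard ⟨X₀, hX₀⟩
    exact ⟨X, hX, fun Y hY => (le_total X.ncard Y.ncard).elim id (hmin hY)⟩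
  have hXk : X.ncard ≤ k := by
    obtain ⟨X₀, hX₀, h⟩ := hk B hB
    exact (hmin X₀ hX₀).trans h
  have hXadm : Admissible k B X := fun h => absurd hXk h.not_ge
  refine hno ?_
  suffices hs : HasDecomp H (Admissible k B) Set.univ X by
    obtain ⟨d, hd, t, -⟩ := hs
    exact ⟨d, hd, t, Set.empty_subset _⟩
  refine HasDecomp.of_isComp hXadm fun C hC => ?_
  by_cases htouch : ∀ U ∈ B, Touch H C U
  · have hCB : C ∉ B := fun h => by
      obtain ⟨x, hxC, hxX⟩ := hX C h
      exact hC.disj x hxC hxX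
    have hB' : IsBramble H (insert C B) := by
      constructor
      · rintro U (rfl | hU)
        · exact hC.conn
        · exact hB.1 U hU
      · rintro U (rfl | hU) U' (rfl | hU')
        · obtain ⟨c, hc⟩ := hC.conn.1
          exact ⟨c, hc, c, hc, .inl rfl⟩
        · exact htouch U' hU'
        · exact (htouch U hU).symm
        · exact hB.2 U hU U' hU'
    obtain ⟨d, hd, t₀, -⟩ := ih (insert C B) (Set.ssubset_insert hCB) hB'
    -- If all bags were admissible for `B`, `d` itself would contradict `hno`. The bag of `s` covers
    -- `B` and is large, so being admissible for `insert C B` it must miss `C`.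
    obtain ⟨s, hs⟩ : ∃ s, ¬ Admissible k B (d.bag s) := by
      by_contra! h
      exact hno ⟨d, h, t₀, Set.empty_subset _⟩
    simp only [Admissible, Classical.not_imp, not_not] at hs
    have hsC : ∀ w ∈ d.bag s, w ∉ C := by
      intro w hw hwC
      refine hd s hs.1 ?_
      rintro U (rfl | hU)
      · exact ⟨w, hwC, hw⟩
      · exact hs.2 U hU
    choose τ hτ using fun x => d.cover x trivial
    refine ⟨d.restrict X C s τ hτ, fun t ht hcov => ?_, s, fun x hx =>
      .inr ⟨hx, fun p => p.start_mem_support⟩⟩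
    refine hd t (ht.trans_le (d.ncard_restrict_le hB hX hmin hC s hs.2 hsC τ hτ t)) ?_
    rintro U (rfl | hU)
    · by_contra hUe
      have : (d.restrict X U s τ hτ).bag t ⊆ X := by
        rintro x (⟨hx, hx' | hx'⟩ | hx)
        · exact hx'
        · exact absurd ⟨x, hx', hx⟩ hUe
        · exact hx.1
      exact absurd ((Set.ncard_le_ncard this (Set.toFinite _)).trans hXk) ht.not_ge
    · obtain ⟨x, hxU, hx | ⟨hx, hsep⟩⟩ := hcov U hU
      · exact ⟨x, hxU, hx.1⟩
      · obtain ⟨a, haU, ha⟩ := hs.2 U hU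
        obtain ⟨p, hp⟩ := (hB.1 U hU).2 a haU x hxU
        obtain ⟨w, hw, hwt⟩ := d.exists_mem_bag_of_walk p s ha (hτ x) hsep
        exact ⟨w, hp w hw, hwt⟩
  · push Not at htouch
    obtain ⟨U, hU, hCU⟩ := htouch
    -- Here two bags suffice: `X`, and `C` with its neighbours in `X`. The second misses `U`, so its
    -- size is irrelevant.
    let N : Set W := {x | x ∈ X ∧ ∃ c ∈ C, H.Adj c x}
    have hY : Admissible k B (C ∪ N) := by
      intro _ hcov
      obtain ⟨x, hxU, hx | ⟨hx, c, hc, hcx⟩⟩ := hcov U hU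
      · exact hCU ⟨x, hx, x, hxU, .inl rfl⟩
      · exact hCU ⟨c, hc, x, hxU, .inr hcx⟩
    have hint : X ∩ (C ∪ N) ⊆ N := by
      rintro x ⟨hx, hx' | hx'⟩
      · exact absurd hx (hC.disj x hx')
      · exact hx'
    have := (HasDecomp.single H hXadm).join (HasDecomp.single H hY) Set.inter_subset_left
      Set.inter_subset_right (by
        rintro x hx y (hy | hy) hxy
        · exact .inl (.inr ⟨hx, y, hy, hxy.symm⟩)
        · exact .inr hy.1)
    convert this using 1
    ext x
    simp only [Set.mem_union, N, Set.mem_ofPred_eq]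
    tauto

/-- If every bramble of `H` has a cover with at most `k + 1` elements, then `H` has treewidth at
most `k`. -/
theorem treewidth_le_of_forall_bramble {W : Type v} [Finite W] (H : SimpleGraph W) (k : ℕ)
    (hk : ∀ B, IsBramble H B → ∃ X, Covers B X ∧ X.ncard ≤ k + 1) : treewidth H ≤ k := by
  -- Every set covers the empty bramble, so admissible bags have at most `k + 1` vertices.
  obtain ⟨d, hd, -⟩ := hasDecomp_of_forall_bramble H (k + 1) hk ∅ ⟨by simp, by simp⟩
  let e : TreeDecomposition H :=
    { Node := d.Node
      T := d.T
      isTree := d.isTree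
      bag := d.bag
      exists_mem_bag := fun x => d.cover x trivial
      inter_subset := fun t t'' p hp t' ht' => d.sep t' t t'' (.of_isPath d.isTree hp ht')
      exists_adj_mem_bag := fun x y h => d.adj x trivial y trivial h }
  refine (iInf_le _ e).trans (iSup_le fun t => ?_)
  have h : (d.bag t).ncard ≤ k + 1 := not_lt.1 fun h => hd t h (by simp [Covers])
  rw [tsub_le_iff_right, ← (Set.toFinite (e.bag t)).cast_ncard_eq]
  exact_mod_cast h

/-! ### Shadows and walks in a fat minor -/

lemma not_farApart_of_edist_le {V : Type u} {G : SimpleGraph V} {D n : ℕ} {A B : Set V} {a b c : V}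
    (hn : 2 * n < D) (ha : a ∈ A) (hb : b ∈ B) (hac : G.edist a c ≤ n) (hbc : G.edist b c ≤ n) :
    ¬ FarApart G D A B := fun h => by
  have h1 : G.edist a b ≤ (n : ℕ∞) + n :=
    G.edist_triangle.trans (add_le_add hac (G.edist_comm (u := c) ▸ hbc))
  have h2 : (D : ℕ∞) ≤ (n + n : ℕ) := by push_cast; exact (h a ha b hb).trans h1
  have := Nat.cast_le.1 h2
  omega

/-- A ball of small radius meets the parts of a fat minor only at one vertex of `H` and at edges
incident with it. -/
lemma FatMinor.exists_vertex_of_ball {W : Type v} {V : Type u} [Nonempty W] {D n : ℕ}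
    {H : SimpleGraph W} {G : SimpleGraph V} (M : FatMinor D H G) (hn : 2 * n < D) (c : V) :
    ∃ x : W, (∀ z, (∃ w ∈ (M.branch z).verts, G.edist w c ≤ n) → z = x) ∧
      ∀ e : H.edgeSet, (∃ w ∈ (M.path e).support, G.edist w c ≤ n) → x ∈ (e : Sym2 W) := by
  by_cases h : ∃ x, ∃ w ∈ (M.branch x).verts, G.edist w c ≤ n
  · obtain ⟨x, w, hw, hwc⟩ := h
    refine ⟨x, ?_, ?_⟩
    · rintro z ⟨w', hw', hwc'⟩
      by_contra hne
      exact not_farApart_of_edist_le hn hw' hw hwc' hwc (M.branch_far z x hne)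
    · rintro e ⟨w', hw', hwc'⟩
      by_contra hne
      exact not_farApart_of_edist_le hn hw (B := {w | w ∈ (M.path e).support}) hw' hwc hwc'
        (M.branch_path_far x e hne)
  · by_cases h' : ∃ e : H.edgeSet, ∃ w ∈ (M.path e).support, G.edist w c ≤ n
    · obtain ⟨⟨e, he⟩, w, hw, hwc⟩ := h'
      induction e with
      | _ x y =>
      -- Either end of the edge would serve, since no branch set and no other path is near `c`.
      refine ⟨x, fun z hz => absurd ⟨z, hz⟩ h, ?_⟩
      rintro f ⟨w', hw', hwc'⟩
      by_cases hne : f = ⟨s(x, y), he⟩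
      · simp [hne]
      · exact absurd (M.path_far f _ hne) (not_farApart_of_edist_le hn
          (A := {w | w ∈ (M.path f).support})
          (B := {w | w ∈ (M.path ⟨s(x, y), he⟩).support}) hw' hw hwc' hwc)
    · exact ⟨Classical.arbitrary W, fun z hz => absurd ⟨z, hz⟩ h,
        fun e he => absurd ⟨e, he⟩ h'⟩

/-- There is a walk from `a` to `b` inside `S`. -/
def WalkIn {V : Type u} (G : SimpleGraph V) (S : Set V) (a b : V) : Prop :=
  ∃ p : G.Walk a b, ∀ w ∈ p.support, w ∈ S

lemma WalkIn.symm {V : Type u} {G : SimpleGraph V} {S : Set V} {a b : V} (h : WalkIn G S a b) :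
    WalkIn G S b a := by
  obtain ⟨p, hp⟩ := h
  exact ⟨p.reverse, by simpa using hp⟩

lemma WalkIn.trans {V : Type u} {G : SimpleGraph V} {S : Set V} {a b c : V} (h : WalkIn G S a b)
    (h' : WalkIn G S b c) : WalkIn G S a c := by
  obtain ⟨p, hp⟩ := h
  obtain ⟨q, hq⟩ := h'
  refine ⟨p.append q, fun w hw => ?_⟩
  rw [SimpleGraph.Walk.mem_support_append_iff] at hw
  exact hw.elim (hp w) (hq w)

lemma WalkIn.of_connected {V : Type u} {G : SimpleGraph V} {K : G.Subgraph} (hK : K.Connected)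
    {S : Set V} (hS : K.verts ⊆ S) {a b : V} (ha : a ∈ K.verts) (hb : b ∈ K.verts) :
    WalkIn G S a b := by
  obtain ⟨p, hp⟩ := (K.connected_iff_forall_exists_walk_subgraph.1 hK).2 ha hb
  exact ⟨p, fun w hw => hS (hp.1 (by simpa using hw))⟩

/-- The union of the branch sets of the vertices in `A` and the paths of the edges in `E`. -/
def FatMinor.region {W : Type v} {V : Type u} {D : ℕ} {H : SimpleGraph W} {G : SimpleGraph V}
    (M : FatMinor D H G) (A : Set W) (E : Set H.edgeSet) : Set V :=
  {w | (∃ z ∈ A, w ∈ (M.branch z).verts) ∨ ∃ e ∈ E, w ∈ (M.path e).support}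

/-- A chosen vertex of the branch set of `x`. -/
noncomputable def FatMinor.home {W : Type v} {V : Type u} {D : ℕ} {H : SimpleGraph W}
    {G : SimpleGraph V} (M : FatMinor D H G) (x : W) : V :=
  ((M.branch x).connected_iff_forall_exists_walk_subgraph.1 (M.branch_connected x)).1.some

lemma FatMinor.home_mem {W : Type v} {V : Type u} {D : ℕ} {H : SimpleGraph W}
    {G : SimpleGraph V} (M : FatMinor D H G) (x : W) : M.home x ∈ (M.branch x).verts :=
  Set.Nonempty.some_mem _

lemma FatMinor.walkIn_of_adj {W : Type v} {V : Type u} {D : ℕ} {H : SimpleGraph W}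
    {G : SimpleGraph V} (M : FatMinor D H G) {A : Set W} {E : Set H.edgeSet} {x y : W}
    (h : H.Adj x y) (hx : x ∈ A) (hy : y ∈ A) (he : ⟨s(x, y), h⟩ ∈ E) :
    WalkIn G (M.region A E) (M.home x) (M.home y) := by
  have hb : ∀ z ∈ A, (M.branch z).verts ⊆ M.region A E := fun z hz w hw => .inl ⟨z, hz, hw⟩
  have hp : WalkIn G (M.region A E) (M.src ⟨s(x, y), h⟩) (M.tgt ⟨s(x, y), h⟩) :=
    ⟨M.path _, fun w hw => .inr ⟨_, he, hw⟩⟩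
  rcases M.path_ends x y h with ⟨h1, h2⟩ | ⟨h1, h2⟩
  · exact (WalkIn.of_connected (M.branch_connected x) (hb x hx) (M.home_mem x) h1).trans
      (hp.trans (.of_connected (M.branch_connected y) (hb y hy) h2 (M.home_mem y)))
  · exact (WalkIn.of_connected (M.branch_connected x) (hb x hx) (M.home_mem x) h2).trans
      (hp.symm.trans (.of_connected (M.branch_connected y) (hb y hy) h1 (M.home_mem y)))

lemma FatMinor.walkIn_of_walk {W : Type v} {V : Type u} {D : ℕ} {H : SimpleGraph W}
    {G : SimpleGraph V} (M : FatMinor D H G) {A : Set W} {E : Set H.edgeSet} {x y : W}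
    (p : H.Walk x y) (hA : ∀ w ∈ p.support, w ∈ A)
    (hE : ∀ e : H.edgeSet, (∀ w ∈ (e : Sym2 W), w ∈ p.support) → e ∈ E) :
    WalkIn G (M.region A E) (M.home x) (M.home y) := by
  induction p with
  | nil =>
    rename_i x
    exact .of_connected (M.branch_connected x) (fun w hw => .inl ⟨x, hA x (by simp), hw⟩)
      (M.home_mem x) (M.home_mem x)
  | @cons x y z h p ih =>
    have h1 := M.walkIn_of_adj (A := A) (E := E) h (hA x (by simp)) (hA y (by simp))
      (hE _ (by simp))
    exact h1.trans (ih (fun w hw => hA w (by simp [hw]))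
      (fun e he => hE e fun w hw => by simp [he w hw]))

/-- There is a common bound for the lengths of shortest walks between homes in the regions. -/
lemma FatMinor.exists_length_bound {W : Type v} {V : Type u} [Finite W] {D : ℕ}
    {H : SimpleGraph W} {G : SimpleGraph V} (M : FatMinor D H G) :
    ∃ L > 0, ∀ A E x y, WalkIn G (M.region A E) (M.home x) (M.home y) →
      ∃ p : G.Walk (M.home x) (M.home y), p.IsPath ∧ p.length ≤ L ∧
        ∀ w ∈ p.support, w ∈ M.region A E := by
  classical
  have : ∀ i : Set W × Set H.edgeSet × W × W, ∃ L : ℕ,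
      WalkIn G (M.region i.1 i.2.1) (M.home i.2.2.1) (M.home i.2.2.2) →
      ∃ p : G.Walk (M.home i.2.2.1) (M.home i.2.2.2), p.IsPath ∧ p.length ≤ L ∧
        ∀ w ∈ p.support, w ∈ M.region i.1 i.2.1 := by
    intro i
    by_cases h : WalkIn G (M.region i.1 i.2.1) (M.home i.2.2.1) (M.home i.2.2.2)
    · obtain ⟨p, hp⟩ := h
      exact ⟨p.bypass.length, fun _ => ⟨p.bypass, p.bypass_isPath, le_rfl,
        fun w hw => hp w (p.support_bypass_subset_support hw)⟩⟩
    · exact ⟨0, fun h' => absurd h' h⟩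
  choose L hL using this
  obtain ⟨K, hK⟩ := Finite.exists_le L
  -- The index set is finite. The successor only makes the bound positive, as a robber speed must
  -- be.
  refine ⟨K + 1, by omega, fun A E x y h => ?_⟩
  obtain ⟨p, hp, hp', hp''⟩ := hL (A, E, x, y) h
  exact ⟨p, hp, (hp'.trans (hK _)).trans (Nat.le_succ K), hp''⟩

/-! ### The robber's strategy -/

/-- Two touching connected sets that avoid `Y` lie in the same part of `H - Y`. -/
lemma exists_walk_of_touch {W : Type v} {H : SimpleGraph W} {U U' Y : Set W}
    (hU : ConnSet H U) (hU' : ConnSet H U') (h : Touch H U U') (hd : ∀ w ∈ U, w ∉ Y)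
    (hd' : ∀ w ∈ U', w ∉ Y) {x y : W} (hx : x ∈ U) (hy : y ∈ U') :
    ∃ p : H.Walk x y, ∀ w ∈ p.support, w ∉ Y := by
  obtain ⟨a, ha, b, hb, hab⟩ := h
  obtain ⟨p, hp⟩ := hU.2 x hx a ha
  obtain ⟨q, hq⟩ := hU'.2 b hb y hy
  rcases hab with rfl | hab
  · refine ⟨p.append q, fun w hw => ?_⟩
    rw [SimpleGraph.Walk.mem_support_append_iff] at hw
    exact hw.elim (fun h => hd w (hp w h)) (fun h => hd' w (hq w h))
  · refine ⟨p.append (.cons hab q), fun w hw => ?_⟩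
    rw [SimpleGraph.Walk.mem_support_append_iff, SimpleGraph.Walk.support_cons,
      List.mem_cons] at hw
    rcases hw with hw | rfl | hw
    · exact hd w (hp w hw)
    · exact hd w ha
    · exact hd' w (hq w hw)

/-- If the balls around the cops' positions `c'` are avoided by everything in `H` that avoids any
choice between the old and the new shadows of the cops, then the robber can follow the bramble. -/
lemma exists_region_walk {W : Type v} {V : Type u} [Finite W] {D k : ℕ} {H : SimpleGraph W}
    {G : SimpleGraph V} (M : FatMinor D H G) {B : Set (Set W)} (hB : IsBramble H B)
    (hk : ∀ X, Covers B X → k + 1 < X.ncard) {A : Set W} {E : Set H.edgeSet} (a b : Fin k → W)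
    (hA : ∀ z, z ∉ A → ∃ j, z = a j ∧ z = b j)
    (hE : ∀ e, e ∉ E → ∃ j, a j ∈ (e : Sym2 W) ∧ b j ∈ (e : Sym2 W))
    {U U' : Set W} (hU : U ∈ B) (hU' : U' ∈ B) (ha : ∀ w ∈ U, w ∉ Set.range a)
    (hb : ∀ w ∈ U', w ∉ Set.range b) {x y : W} (hx : x ∈ U) (hy : y ∈ U') :
    WalkIn G (M.region A E) (M.home x) (M.home y) := by
  classical
  -- The cops in `S` show their new shadows, the others their old ones. A blocked part lies at both
  -- shadows of some cop, so a walk avoiding any such mixture uses no blocked part.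
  let m : Finset (Fin k) → Fin k → W := fun S j => if j ∈ S then b j else a j
  have hmix : ∀ S, ∀ T ∈ B, ∀ T' ∈ B, (∀ w ∈ T, w ∉ Set.range (m S)) →
      (∀ w ∈ T', w ∉ Set.range (m S)) → ∀ x ∈ T, ∀ y ∈ T',
      WalkIn G (M.region A E) (M.home x) (M.home y) := by
    intro S T hT T' hT' hd hd' x hx y hy
    obtain ⟨p, hp⟩ := exists_walk_of_touch (hB.1 T hT) (hB.1 T' hT') (hB.2 T hT T' hT') hd hd' hx hy
    refine M.walkIn_of_walk p (fun w hw => ?_) (fun e he => ?_)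
    · by_contra hwA
      obtain ⟨j, h1, h2⟩ := hA w hwA
      refine hp w hw ⟨j, ?_⟩
      by_cases hj : j ∈ S
      · simp [m, hj, ← h2]
      · simp [m, hj, ← h1]
    · by_contra heE
      obtain ⟨j, h1, h2⟩ := hE e heE
      have hm : m S j ∈ (e : Sym2 W) := by
        by_cases hj : j ∈ S
        · simpa [m, hj] using h2
        · simpa [m, hj] using h1
      exact hp _ (he _ hm) ⟨j, rfl⟩
  suffices hs : ∀ S : Finset (Fin k), ∀ T ∈ B, (∀ w ∈ T, w ∉ Set.range (m S)) → ∀ y ∈ T,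
      WalkIn G (M.region A E) (M.home x) (M.home y) from
    hs Finset.univ U' hU' (by simpa [m] using hb) y hy
  intro S
  induction S using Finset.induction_on with
  | empty =>
    intro T hT hd y hy
    exact hmix ∅ U hU T hT (by simpa [m] using ha) hd x hx y hy
  | insert j S hj ih =>
    intro T hT hd y hy
    -- These `k + 1` vertices contain the mixtures before and after switching cop `j`; a bramble set
    -- avoiding them all links the two stages.
    have hcard : (insert (b j) (Set.range (m S))).ncard ≤ k + 1 := by
      refine (Set.ncard_insert_le _ _).trans (Nat.succ_le_succ ?_)
      rw [← Set.image_univ]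
      exact (Set.ncard_image_le (Set.toFinite _)).trans (by simp [Set.ncard_univ])
    have hnot : ¬ Covers B (insert (b j) (Set.range (m S))) := fun h => absurd (hk _ h) hcard.not_gt
    simp only [Covers, not_forall, Set.not_nonempty_iff_eq_empty] at hnot
    obtain ⟨T', hT', he⟩ := hnot
    have hd' : ∀ w ∈ T', w ∉ insert (b j) (Set.range (m S)) := fun w hw hw' =>
      (he ▸ (⟨hw, hw'⟩ : w ∈ T' ∩ _) : w ∈ (∅ : Set W))
    obtain ⟨z, hz⟩ := (hB.1 T' hT').1
    refine (ih T' hT' (fun w hw h => hd' w hw (.inr h)) z hz).trans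
      (hmix (insert j S) T' hT' T hT ?_ hd z hz y hy)
    rintro w hw ⟨i, rfl⟩
    refine hd' _ hw ?_
    by_cases hi : i = j
    · subst hi; simp [m]
    · exact .inr ⟨i, by simp [m, hi]⟩

/-- If `H` has a bramble without covers of size at most `k + 1`, then the robber escapes `k` cops on
every graph that has `H` as an asymptotic minor. -/
theorem not_isWeakCopWin_of_bramble {W : Type v} {V : Type u} [Finite W] {H : SimpleGraph W}
    {G : SimpleGraph V} (hG : G.Connected) (hHG : IsAsymptoticMinor H G) {k : ℕ}
    {B : Set (Set W)} (hB : IsBramble H B) (hk : ∀ X, Covers B X → k + 1 < X.ncard) :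
    ¬ IsWeakCopWin G k := by
  rintro ⟨sc, -, ρ, hwin⟩
  have hex : ∀ X : Set W, X.ncard ≤ k + 1 → ∃ U ∈ B, ∀ w ∈ U, w ∉ X := by
    intro X hX
    have hnot : ¬ Covers B X := fun h => absurd (hk _ h) hX.not_gt
    simp only [Covers, not_forall, Set.not_nonempty_iff_eq_empty] at hnot
    obtain ⟨U, hU, he⟩ := hnot
    exact ⟨U, hU, fun w hw hw' => (he ▸ (⟨hw, hw'⟩ : w ∈ U ∩ _) : w ∈ (∅ : Set W))⟩
  have hne : Nonempty W := by
    obtain ⟨U, hU, -⟩ := hex ∅ (by simp)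
    exact ⟨(hB.1 U hU).1.some⟩
  -- A vertex within `ρ` of a new cop position is within `ρ + sc` of the old one; fatness must
  -- exceed twice this radius.
  obtain ⟨M⟩ := hHG (2 * (ρ + sc) + 1) (by omega)
  choose X hX hXe using M.exists_vertex_of_ball (n := ρ + sc) (by omega)
  have hchoice : ∀ c : Fin k → V, ∃ U ∈ B, ∀ w ∈ U, w ∉ Set.range (X ∘ c) := fun c => by
    refine hex _ ?_
    rw [← Set.image_univ]
    exact (Set.ncard_image_le (Set.toFinite _)).trans (by simp [Set.ncard_univ])
  choose U hU hUX using hchoice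
  choose f hf using fun c => (hB.1 (U c) (hU c)).1
  obtain ⟨L, hL, hlen⟩ := M.exists_length_bound
  have hmove : ∀ c c' : Fin k → V, (∀ j, G.edist (c j) (c' j) ≤ sc) →
      RobberMove G ρ L c' (M.home (f c)) (M.home (f c')) := by
    intro c c' hcc
    let Z : Set V := {w | ∀ j, (ρ : ℕ∞) < G.edist w (c' j)}
    have hball : ∀ w, w ∉ Z → ∃ j, G.edist w (c j) ≤ (ρ + sc : ℕ) ∧
        G.edist w (c' j) ≤ (ρ + sc : ℕ) := by
      intro w hw
      have hw : ∃ j, ¬ (ρ : ℕ∞) < G.edist w (c' j) := not_forall.1 hw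
      obtain ⟨j, hj⟩ := hw
      rw [not_lt] at hj
      refine ⟨j, ?_, ?_⟩
      · push_cast
        exact G.edist_triangle.trans (add_le_add hj (G.edist_comm (u := c j) ▸ hcc j))
      · push_cast
        exact hj.trans le_self_add
    have hreg := exists_region_walk M hB hk (A := {z | (M.branch z).verts ⊆ Z})
      (E := {e | ∀ w ∈ (M.path e).support, w ∈ Z}) (X ∘ c) (X ∘ c')
      (fun z hz => by
        obtain ⟨w, hw, hwZ⟩ := Set.not_subset.1 hz
        obtain ⟨j, h1, h2⟩ := hball w hwZ
        exact ⟨j, hX _ z ⟨w, hw, h1⟩, hX _ z ⟨w, hw, h2⟩⟩)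
      (fun e he => by
        have he : ∃ w ∈ (M.path e).support, w ∉ Z := by
          by_contra! h
          exact he h
        obtain ⟨w, hw, hwZ⟩ := he
        obtain ⟨j, h1, h2⟩ := hball w hwZ
        exact ⟨j, hXe _ e ⟨w, hw, h1⟩, hXe _ e ⟨w, hw, h2⟩⟩)
      (hU c) (hU c') (hUX c) (hUX c') (hf c) (hf c')
    obtain ⟨p, hp, hpL, hpr⟩ := hlen _ _ _ _ hreg
    refine ⟨p, hp, hpL, fun w hw => ?_⟩
    rcases hpr w hw with ⟨z, hz, hwz⟩ | ⟨e, he, hwe⟩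
    · exact hz hwz
    · exact he w hwe
  obtain ⟨v⟩ := hG.nonempty
  -- The robber only rests at the finitely many homes, so he never leaves this ball. Speed and
  -- radius may depend on the minor because they are chosen after `sc` and `ρ`.
  obtain ⟨R, hR⟩ := Finite.exists_le fun x => G.dist v (M.home x)
  obtain ⟨σ, hσ⟩ := hwin L hL (R + 1) (by omega) v
  -- Robber and cops determine each other's moves; recursion on the history resolves the
  -- circularity.
  let hist : ℕ → List V := fun n => n.rec [] fun _ h => M.home (f (σ.pos h)) :: h
  let r : ℕ → V := fun n => M.home (f (σ.pos (hist n)))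
  have hhist : ∀ n, history r n = hist n := by
    intro n
    induction n with
    | zero => rfl
    | succ n ih => simp only [history, ih]; rfl
  have hr : ∀ n, r n = M.home (f (σ.copsAt r n)) := fun n => by
    rw [CopStrategy.copsAt, hhist]
  have hstep : ∀ n, RobberMove G ρ L (σ.copsAt r (n + 1)) (r n) (r (n + 1)) := fun n => by
    rw [hr n, hr (n + 1)]
    exact hmove _ _ fun j => σ.speed _ _ j
  rcases hσ r fun n _ => hstep n with ⟨i, j, hj⟩ | ⟨N, -, hN⟩
  -- The robber's path starts at `r i`, already out of reach of the cops' new positions.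
  · obtain ⟨p, -, -, hp⟩ := hstep i
    exact absurd hj (hp _ p.start_mem_support j).not_ge
  · have h1 := hN N le_rfl
    rw [← (hG.preconnected v (r N)).coe_dist_eq_edist] at h1
    have h2 := hR (f (σ.pos (hist N)))
    have h3 := Nat.cast_lt.1 h1
    change G.dist v (r N) ≤ R at h2
    omega

end CoarseCops

theorem theorem5p2 {W : Type v} {V : Type u} [Finite W] (H : SimpleGraph W) (G : SimpleGraph V)
    (hG : G.Connected) (hHG : CoarseCops.IsAsymptoticMinor H G) :
    CoarseCops.treewidth H ≤ CoarseCops.weakCopNumber G := by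
  refine le_iInf₂ fun k hk => CoarseCops.treewidth_le_of_forall_bramble H k fun B hB => ?_
  by_contra! h
  exact CoarseCops.not_isWeakCopWin_of_bramble hG hHG hB h hk
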